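/- Let $\mathbb{F}$ be $\mathbb{R}$ or $\mathbb{C}$ and let $n\ge 1$. For $n\times n$ matrices $A_k=(a_{ijk})_{i,j}$ ($k=1,2,3$) over $\mathbb{F}$, let $T=(A_1;A_2;A_3)$ denote the tensor $\sum_{i,j,k}a_{ijk}\,e_i\otimes e_j\otimes e_k\in\mathbb{F}^n\otimes\mathbb{F}^n\otimes\mathbb{F}^3$, and let $\operatorname{rank}_{\mathbb{F}}T$ be the least $r\ge 0$ such that $T=\sum_{l=1}^{r}u_l\otimes v_l\otimes w_l$ for some $u_l,v_l\in\mathbb{F}^n$ and $w_l\in\mathbb{F}^3$. If the $\mathbb{F}$-linear span $\langle A_1,A_2,A_3\rangle$ contains a nonzero singular matrix, then $\operatorname{rank}_{\mathbb{F}}T\le 2n-1$. In particular, if $\mathbb{F}=\mathbb{C}$ or $n$ is odd, then $\operatorname{rank}_{\mathbb{F}}T\le 2n-1$ for every $n\times n\times 3$ tensor $T=(A_1;A_2;A_3)$ over $\mathbb{F}$. -/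

import Mathlib

open scoped TensorProduct

/-- The tensor `∑ a_{ijk} e_i ⊗ e_j ⊗ e_k` in `F^m ⊗ F^n ⊗ F^p` whose `k`-th slice is the
`m × n` matrix `A k = (a_{ijk})_{ij}`, i.e. the tensor `(A_1; …; A_p)`. -/
noncomputable def tensorOfSlices {F : Type*} [Field F] {m n p : ℕ}
    (A : Fin p → Matrix (Fin m) (Fin n) F) :
    (Fin m → F) ⊗[F] (Fin n → F) ⊗[F] (Fin p → F) :=
  ∑ i, ∑ j, ∑ k, A k i j •
    ((Pi.single i 1 : Fin m → F) ⊗ₜ[F] (Pi.single j 1 : Fin n → F) ⊗ₜ[F]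
      (Pi.single k 1 : Fin p → F))

/-- `x` is a sum of `r` tensors of the form `a ⊗ b ⊗ c`. -/
def IsSumOfSimpleTensors {F : Type*} [Field F] {m n p : ℕ}
    (x : (Fin m → F) ⊗[F] (Fin n → F) ⊗[F] (Fin p → F)) (r : ℕ) : Prop :=
  ∃ (a : Fin r → Fin m → F) (b : Fin r → Fin n → F) (c : Fin r → Fin p → F),
    x = ∑ l, a l ⊗ₜ[F] b l ⊗ₜ[F] c l

/-- Every tensor is a finite sum of simple tensors, so the minimum defining the rank exists. -/
theorem exists_isSumOfSimpleTensors {F : Type*} [Field F] {m n p : ℕ}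
    (x : (Fin m → F) ⊗[F] (Fin n → F) ⊗[F] (Fin p → F)) :
    ∃ r, IsSumOfSimpleTensors x r := by
  have hadd : ∀ x y : (Fin m → F) ⊗[F] (Fin n → F) ⊗[F] (Fin p → F),
      (∃ r, IsSumOfSimpleTensors x r) → (∃ r, IsSumOfSimpleTensors y r) →
      ∃ r, IsSumOfSimpleTensors (x + y) r := by
    rintro x y ⟨r, a, b, c, rfl⟩ ⟨s, a', b', c', rfl⟩
    exact ⟨r + s, Fin.append a a', Fin.append b b', Fin.append c c', by
      simp [Fin.sum_univ_add]⟩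
  induction x using TensorProduct.induction_on with
  | zero => exact ⟨0, Fin.elim0, Fin.elim0, Fin.elim0, by simp⟩
  | add x y hx hy => exact hadd x y hx hy
  | tmul u c =>
    induction u using TensorProduct.induction_on with
    | zero => exact ⟨0, Fin.elim0, Fin.elim0, Fin.elim0, by simp⟩
    | add u v hu hv =>
      rw [TensorProduct.add_tmul]
      exact hadd _ _ hu hv
    | tmul a b => exact ⟨1, fun _ => a, fun _ => b, fun _ => c, by simp⟩

/-- The rank over `F` of a tensor `x`: the least `r` such that `x` is a sum of `r` tensors of the
form `a ⊗ b ⊗ c`. -/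
noncomputable def tensorRank {F : Type*} [Field F] {m n p : ℕ}
    (x : (Fin m → F) ⊗[F] (Fin n → F) ⊗[F] (Fin p → F)) : ℕ :=
  sInf {r : ℕ | IsSumOfSimpleTensors x r}

/-! It suffices to put the three slices in the span of `2 * n - 1` rank-one matrices
(`RankOneCovered`). For a singular slice `B`, induct on `n`. Row and column operations make `B =
diag β` with `β o = 0`. Diagonal matrices vanishing at `o` cost `n - 1`, so `A` and `A'` may be
altered by such matrices and must then be covered by `n` rank-one matrices; this is possible if the
altered pencil is regular with `n` distinct eigenvalues.

`of_sum_block` arranges this by perturbation once some principal block through `o` has a pencil with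
distinct eigenvalues. A nonzero `(o, o)` entry gives a block of size 1; otherwise independent
entries in row and column `o` give one of size 2, after normalization. A zero row or column is easy,
and in the remaining case row and column `o` of `A` and `A'` are proportional: `of_peel` removes
them with two rank-one matrices and keeps a singular slice for the induction.

A singular combination arises from an eigenvalue of `A₁⁻¹ * A₂` over `ℂ` or in odd size. -/

open Matrix in
/-- All matrices of `S` lie in the span of `m` rank-one matrices `u l * (v l)ᵀ`. -/
def RankOneCovered {F ι : Type*} [Field F] (S : Set (Matrix ι ι F)) (m : ℕ) : Prop :=
  ∃ u v : Fin m → ι → F, S ⊆ Submodule.span F (Set.range fun l => vecMulVec (u l) (v l))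

/-! ### Coverings by rank-one matrices -/

namespace RankOneCovered

open Matrix

variable {F ι κ : Type*} [Field F]

theorem of_fintype {τ : Type*} [Fintype τ] {S : Set (Matrix ι ι F)} (u v : τ → ι → F)
    (h : S ⊆ Submodule.span F (Set.range fun l => vecMulVec (u l) (v l))) :
    RankOneCovered S (Fintype.card τ) := by
  let e := Fintype.equivFin τ
  refine ⟨u ∘ e.symm, v ∘ e.symm, ?_⟩
  have : Set.range (fun l => vecMulVec ((u ∘ e.symm) l) ((v ∘ e.symm) l)) =
      Set.range fun l => vecMulVec (u l) (v l) :=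
    e.symm.surjective.range_comp (fun l => vecMulVec (u l) (v l))
  rwa [this]

theorem of_subset_span {S T : Set (Matrix ι ι F)} {m : ℕ} (hT : RankOneCovered T m)
    (h : S ⊆ Submodule.span F T) : RankOneCovered S m := by
  obtain ⟨u, v, huv⟩ := hT
  exact ⟨u, v, h.trans (Submodule.span_le.2 huv)⟩

theorem union {S T : Set (Matrix ι ι F)} {m k : ℕ} (hS : RankOneCovered S m)
    (hT : RankOneCovered T k) : RankOneCovered (S ∪ T) (m + k) := by
  obtain ⟨u, v, huv⟩ := hS
  obtain ⟨u', v', huv'⟩ := hT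
  have := of_fintype (S := S ∪ T) (Sum.elim u u') (Sum.elim v v') (by
    have : (fun l => vecMulVec (Sum.elim u u' l) (Sum.elim v v' l)) =
        Sum.elim (fun l => vecMulVec (u l) (v l)) (fun l => vecMulVec (u' l) (v' l)) := by
      ext (l | l) <;> rfl
    rw [this, Set.Sum.elim_range]
    exact Set.union_subset
      (huv.trans (Submodule.span_mono Set.subset_union_left))
      (huv'.trans (Submodule.span_mono Set.subset_union_right)))
  simpa using this

theorem image {S : Set (Matrix κ κ F)} {m : ℕ} (hS : RankOneCovered S m)
    (Φ : Matrix κ κ F →ₗ[F] Matrix ι ι F) (p q : (κ → F) → ι → F)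
    (hΦ : ∀ u v, Φ (vecMulVec u v) = vecMulVec (p u) (q v)) : RankOneCovered (Φ '' S) m := by
  obtain ⟨u, v, huv⟩ := hS
  refine ⟨fun l => p (u l), fun l => q (v l), ?_⟩
  have h : (fun l => vecMulVec (p (u l)) (q (v l))) = Φ ∘ fun l => vecMulVec (u l) (v l) := by
    ext1 l; exact (hΦ _ _).symm
  rw [h, Set.range_comp, Submodule.span_image]
  exact Set.image_mono huv

/-- Coverings are transported by `X ↦ P * X * Q`. -/
theorem mul_mul [Fintype κ] {S : Set (Matrix κ κ F)} {m : ℕ} (hS : RankOneCovered S m)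
    (P : Matrix ι κ F) (Q : Matrix κ ι F) : RankOneCovered ((fun X => P * X * Q) '' S) m :=
  hS.image (Φ := (mulRightLinearMap ι F Q) ∘ₗ (mulLeftLinearMap κ F P))
    (p := fun u => P *ᵥ u) (q := fun v => v ᵥ* Q)
    (fun u v => by simp [mul_vecMulVec, vecMulVec_mul])

theorem image_submatrix {S : Set (Matrix κ κ F)} {m : ℕ} (hS : RankOneCovered S m) (f g : ι → κ) :
    RankOneCovered ((fun X => X.submatrix f g) '' S) m :=
  hS.image (Φ := { toFun := fun X => X.submatrix f g, map_add' := fun _ _ => rfl,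
                   map_smul' := fun _ _ => rfl })
    (p := fun u => u ∘ f) (q := fun v => v ∘ g) (fun _ _ => rfl)

theorem _root_.Matrix.diagonal_eq_sum_vecMulVec [Fintype ι] [DecidableEq ι] (β : ι → F) :
    diagonal β = ∑ i : ι, β i • vecMulVec (Pi.single i 1) (Pi.single i 1) := by
  ext a b
  simp only [Matrix.sum_apply, Matrix.smul_apply, vecMulVec_apply, smul_eq_mul, diagonal_apply]
  rw [Finset.sum_eq_single a]
  · by_cases hab : a = b <;> simp [hab, eq_comm]
  · intro c _ hc; simp [Pi.single_apply, hc.symm]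
  · simp

/-- The forced zero at `o` saves one matrix unit; this is the `-1` in `2 * n - 1`. -/
theorem diagonal_off [Fintype ι] [DecidableEq ι] (o : ι) :
    RankOneCovered {X : Matrix ι ι F | ∃ β : ι → F, β o = 0 ∧ X = diagonal β}
      (Fintype.card ι - 1) := by
  have h := of_fintype (τ := {i : ι // i ≠ o})
    (S := {X : Matrix ι ι F | ∃ β : ι → F, β o = 0 ∧ X = diagonal β})
    (fun i => Pi.single i.1 1) (fun i => Pi.single i.1 1) (by
      rintro _ ⟨β, hβ, rfl⟩
      rw [diagonal_eq_sum_vecMulVec]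
      refine Submodule.sum_mem _ fun i _ => ?_
      by_cases hi : i = o
      · subst hi; simp [hβ]
      · exact Submodule.smul_mem _ _ (Submodule.subset_span ⟨⟨i, hi⟩, rfl⟩))
  rwa [Fintype.card_subtype_compl, Fintype.card_subtype_eq] at h

theorem diagonal [Fintype ι] [DecidableEq ι] :
    RankOneCovered (Set.range (diagonal : (ι → F) → Matrix ι ι F)) (Fintype.card ι) := by
  refine of_fintype (fun i => Pi.single i 1) (fun i => Pi.single i 1) ?_
  rintro _ ⟨β, rfl⟩
  rw [diagonal_eq_sum_vecMulVec]
  exact Submodule.sum_mem _ fun i _ => Submodule.smul_mem _ _ (Submodule.subset_span ⟨i, rfl⟩)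

theorem pair_vecMulVec (u v u' v' : ι → F) :
    RankOneCovered {vecMulVec u v, vecMulVec u' v'} 2 := by
  refine ⟨![u, u'], ![v, v'], ?_⟩
  rintro _ (rfl | rfl)
  · exact Submodule.subset_span ⟨0, rfl⟩
  · exact Submodule.subset_span ⟨1, rfl⟩

/-- A regular pencil `P + x Q` with as many distinct eigenvalues as its size is covered by that
many rank-one matrices. -/
theorem pencil [Fintype ι] [DecidableEq ι] {P Q : Matrix ι ι F} (hQ : Q.det ≠ 0)
    {x : ι → F} (hx : Function.Injective x) (h : ∀ i, (P + x i • Q).det = 0) :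
    RankOneCovered {P, Q} (Fintype.card ι) := by
  have hQu : IsUnit Q.det := isUnit_iff_ne_zero.2 hQ
  choose v hv0 hv using fun i => exists_mulVec_eq_zero_iff.2 (h i)
  have hPv : ∀ i, P *ᵥ v i = -x i • Q *ᵥ v i := by
    intro i
    have := hv i
    rw [add_mulVec, smul_mulVec] at this
    rw [neg_smul]
    exact eq_neg_of_add_eq_zero_left this
  -- The kernel vectors are eigenvectors of `Q⁻¹ * P` for the distinct eigenvalues `-x i`.
  have hli : LinearIndependent F v := by
    refine Module.End.eigenvectors_linearIndependent' (toLin' (Q⁻¹ * P)) (fun i => -x i)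
      (neg_injective.comp hx) v fun i => ⟨?_, hv0 i⟩
    rw [Module.End.mem_eigenspace_iff, toLin'_apply, ← mulVec_mulVec, hPv, mulVec_smul,
      mulVec_mulVec, nonsing_inv_mul _ hQu, one_mulVec]
  let G : Matrix ι ι F := (of v)ᵀ
  have hG : IsUnit G := linearIndependent_cols_iff_isUnit.1 hli
  have hGd : IsUnit G.det := (isUnit_iff_isUnit_det G).1 hG
  have hPG : P * G = Q * G * Matrix.diagonal (fun i => -x i) := by
    ext a i
    rw [mul_diagonal]
    have := congrFun (hPv i) a
    simp only [mulVec, dotProduct, Pi.smul_apply, smul_eq_mul] at this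
    simp only [mul_apply, G, transpose_apply, of_apply]
    rw [this, mul_comm]
  refine ((diagonal (F := F) (ι := ι)).mul_mul (Q * G) G⁻¹).of_subset_span
    ((Set.pair_subset ?_ ?_).trans Submodule.subset_span)
  · refine ⟨_, ⟨fun i => -x i, rfl⟩, ?_⟩
    simp only [← hPG]
    rw [mul_assoc, mul_nonsing_inv _ hGd, mul_one]
  · refine ⟨_, ⟨fun _ => 1, rfl⟩, ?_⟩
    simp only [diagonal_one, mul_one]
    rw [mul_assoc, mul_nonsing_inv _ hGd, mul_one]

end RankOneCovered

/-! ### From coverings to tensor rank -/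

/-- The coefficients of the slices on the `l`-th rank-one matrix form the third factor of the `l`-th
simple tensor. -/
theorem RankOneCovered.tensorRank_le {F : Type*} [Field F] {n m : ℕ}
    {A₁ A₂ A₃ : Matrix (Fin n) (Fin n) F} (h : RankOneCovered {A₁, A₂, A₃} m) :
    tensorRank (tensorOfSlices ![A₁, A₂, A₃]) ≤ m := by
  obtain ⟨u, v, huv⟩ := h
  have hk : ∀ k, ∃ c : Fin m → F, ∑ l, c l • Matrix.vecMulVec (u l) (v l) = ![A₁, A₂, A₃] k := by
    intro k
    refine (Submodule.mem_span_range_iff_exists_fun F).1 (huv ?_)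
    fin_cases k <;> simp
  choose c hc using hk
  refine Nat.sInf_le ⟨u, v, fun l k => c k l, ?_⟩
  have hsum : ∀ (r : ℕ) (w : Fin r → F), w = ∑ i, w i • (Pi.single i 1 : Fin r → F) := by
    intro r w
    ext a
    simp [Finset.sum_apply, Pi.single_apply]
  have hR : ∀ l, u l ⊗ₜ[F] v l ⊗ₜ[F] (fun k => c k l) = ∑ i, ∑ j, ∑ k, (c k l * (u l i * v l j)) •
    ((Pi.single i 1 : Fin n → F) ⊗ₜ[F] (Pi.single j 1 : Fin n → F) ⊗ₜ[F]
      (Pi.single k 1 : Fin 3 → F)) := by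
    intro l
    have huv : u l ⊗ₜ[F] v l = ∑ i, ∑ j, (u l i * v l j) •
        ((Pi.single i 1 : Fin n → F) ⊗ₜ[F] (Pi.single j 1 : Fin n → F)) := by
      conv_lhs => rw [hsum _ (u l), hsum _ (v l)]
      rw [TensorProduct.sum_tmul]
      refine Finset.sum_congr rfl fun i _ => ?_
      rw [TensorProduct.tmul_sum]
      refine Finset.sum_congr rfl fun j _ => ?_
      rw [TensorProduct.smul_tmul_smul]
    rw [huv, TensorProduct.sum_tmul]
    refine Finset.sum_congr rfl fun i _ => ?_
    rw [TensorProduct.sum_tmul]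
    refine Finset.sum_congr rfl fun j _ => ?_
    conv_lhs => rw [hsum _ (fun k => c k l)]
    rw [TensorProduct.tmul_sum]
    refine Finset.sum_congr rfl fun k _ => ?_
    rw [TensorProduct.smul_tmul_smul, mul_comm]
  simp only [hR, tensorOfSlices, ← hc, Matrix.sum_apply, Matrix.smul_apply,
    Matrix.vecMulVec_apply, smul_eq_mul, Finset.sum_smul]
  rw [Finset.sum_comm]
  simp_rw [Finset.sum_comm (s := (Finset.univ : Finset (Fin m)))]
  rw [Finset.sum_comm]

/-! ### Persistence of simple zeros -/

open Filter Topology in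
/-- A simple zero `a` of `F (·, 0)` persists as a zero of `F (·, ε)` for small `ε`. -/
theorem eventually_exists_zero_near_simple_zero {𝕜 : Type*} [RCLike 𝕜] {f : 𝕜 × 𝕜 → 𝕜}
    (hf : ContDiff 𝕜 1 f) {a d : 𝕜} (h0 : f (a, 0) = 0)
    (hd : HasDerivAt (fun x => f (x, 0)) d a) (hd0 : d ≠ 0) {U : Set 𝕜} (hU : U ∈ 𝓝 a) :
    ∀ᶠ ε in 𝓝 (0 : 𝕜), ∃ x ∈ U, f (x, ε) = 0 := by
  have hs : HasStrictFDerivAt f (fderiv 𝕜 f (a, 0)) (a, 0) :=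
    hf.contDiffAt.hasStrictFDerivAt one_ne_zero
  have hval : fderiv 𝕜 f (a, 0) (1, 0) = d := by
    have h1 : HasDerivAt (fun x : 𝕜 => (x, (0 : 𝕜))) (1, 0) a :=
      (hasDerivAt_id a).prodMk (hasDerivAt_const a 0)
    exact (hs.hasFDerivAt.comp_hasDerivAt a h1).unique hd
  -- Since `d ≠ 0`, the map `(x, ε) ↦ (f (x, ε), ε)` has surjective derivative, so it is open at
  -- `(a, 0)` and reaches `(0, ε)`.
  have hg : HasStrictFDerivAt (fun z : 𝕜 × 𝕜 => (f z, z.2))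
      ((fderiv 𝕜 f (a, 0)).prod (ContinuousLinearMap.snd 𝕜 𝕜 𝕜)) (a, 0) :=
    hs.prodMk hasStrictFDerivAt_snd
  have hsurj : ((fderiv 𝕜 f (a, 0)).prod (ContinuousLinearMap.snd 𝕜 𝕜 𝕜)).range = ⊤ := by
    refine LinearMap.range_eq_top.2 fun ⟨p, q⟩ => ?_
    refine ⟨((p - fderiv 𝕜 f (a, 0) (0, q)) / d, q), ?_⟩
    have : (((p - fderiv 𝕜 f (a, 0) (0, q)) / d, q) : 𝕜 × 𝕜) =
        ((p - fderiv 𝕜 f (a, 0) (0, q)) / d) • ((1, 0) : 𝕜 × 𝕜) + (0, q) := by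
      simp
    simp only [ContinuousLinearMap.coe_coe, ContinuousLinearMap.prod_apply,
      ContinuousLinearMap.coe_snd', Prod.mk.injEq, and_true]
    rw [this, map_add, map_smul, hval, smul_eq_mul, div_mul_cancel₀ _ hd0, sub_add_cancel]
  have hmap := hg.map_nhds_eq_of_surj hsurj
  have hV : U ×ˢ (Set.univ : Set 𝕜) ∈ 𝓝 (a, (0 : 𝕜)) := prod_mem_nhds hU univ_mem
  have himg := hmap ▸ image_mem_map (m := fun z : 𝕜 × 𝕜 => (f z, z.2)) hV
  rw [h0] at himg
  have hc : Tendsto (fun ε : 𝕜 => ((0 : 𝕜), ε)) (𝓝 0) (𝓝 (0, 0)) :=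
    (by fun_prop : Continuous fun ε : 𝕜 => ((0 : 𝕜), ε)).tendsto 0
  filter_upwards [hc himg] with ε hε
  obtain ⟨⟨x, e⟩, ⟨hx, -⟩, hz⟩ := hε
  simp only [Prod.mk.injEq] at hz
  exact ⟨x, hx, hz.2 ▸ hz.1⟩

open Filter Topology in
/-- If `f (·, 0)` is a product of distinct linear factors, then for small `ε` the function
`f (·, ε)` has as many distinct zeros. -/
theorem eventually_exists_injective_zeros {𝕜 ι : Type*} [RCLike 𝕜] [Fintype ι] {f : 𝕜 × 𝕜 → 𝕜}
    (hf : ContDiff 𝕜 1 f) {c : 𝕜} (hc : c ≠ 0) {ξ : ι → 𝕜} (hξ : Function.Injective ξ)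
    (h0 : ∀ x, f (x, 0) = c * ∏ i, (x - ξ i)) :
    ∀ᶠ ε in 𝓝 (0 : 𝕜), ∃ x : ι → 𝕜, Function.Injective x ∧ ∀ i, f (x i, ε) = 0 := by
  classical
  obtain ⟨U, hU, hdisj⟩ := (Set.finite_range ξ).t2_separation
  have key : ∀ i, ∀ᶠ ε in 𝓝 (0 : 𝕜), ∃ x ∈ U (ξ i), f (x, ε) = 0 := by
    intro i
    have hfac : (fun x => f (x, 0)) =
        fun x => (x - ξ i) * (c * ∏ j ∈ Finset.univ.erase i, (x - ξ j)) := by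
      ext x
      rw [h0, ← Finset.mul_prod_erase _ _ (Finset.mem_univ i)]
      ring
    have hdiff : DifferentiableAt 𝕜
        (fun x => c * ∏ j ∈ Finset.univ.erase i, (x - ξ j)) (ξ i) := by
      fun_prop
    have hder := ((hasDerivAt_id (ξ i)).sub_const (ξ i)).mul hdiff.hasDerivAt
    refine eventually_exists_zero_near_simple_zero hf (a := ξ i)
      (d := c * ∏ j ∈ Finset.univ.erase i, (ξ i - ξ j)) ?_ ?_ ?_ ((hU (ξ i)).2.mem_nhds (hU _).1)
    · rw [congrFun hfac (ξ i)]; simp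
    · rw [hfac]; exact hder.congr_deriv (by simp)
    · refine mul_ne_zero hc (Finset.prod_ne_zero_iff.2 fun j hj => sub_ne_zero.2 fun h => ?_)
      exact Finset.ne_of_mem_erase hj (hξ h).symm
  filter_upwards [eventually_all.2 key] with ε hε
  choose x hxU hx using hε
  refine ⟨x, fun i j hij => ?_, hx⟩
  by_contra hne
  exact Set.disjoint_left.1 (hdisj ⟨i, rfl⟩ ⟨j, rfl⟩ (hξ.ne hne)) (hxU i) (hij ▸ hxU j)

/-! ### The perturbation argument -/

theorem exists_injective_sum_extension {F κ σ : Type*} [Infinite F] [Finite κ] [Finite σ]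
    {ξ : σ → F} (hξ : Function.Injective ξ) :
    ∃ lam : κ → F, Function.Injective (Sum.elim lam ξ) := by
  have : Infinite ↥(Set.range ξ)ᶜ := (Set.finite_range ξ).infinite_compl.to_subtype
  have := Fintype.ofFinite κ
  let g : κ ↪ ↥(Set.range ξ)ᶜ := (Fintype.equivFin κ).toEmbedding.trans
    (Fin.valEmbedding.trans (Infinite.natEmbedding _))
  refine ⟨fun k => (g k).1, Function.Injective.sumElim
    (Subtype.val_injective.comp g.injective) hξ fun k s h => (g k).2 ⟨s, h.symm⟩⟩

theorem exists_sum_equiv_of_injective {σ ι : Type*} {f : σ → ι} (hf : Function.Injective f) :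
    ∃ e : ↥(Set.range f)ᶜ ⊕ σ ≃ ι, ∀ s, e (Sum.inr s) = f s := by
  classical
  refine ⟨((Equiv.refl _).sumCongr (Equiv.ofInjective f hf)).trans
    ((Equiv.sumComm _ _).trans (Equiv.Set.sumCompl (Set.range f))), fun s => by simp⟩

open Matrix in
/-- A block of a pencil with distinct eigenvalues controls the number of rank-one matrices needed
together with diagonal matrices vanishing at one position of the block. -/
theorem RankOneCovered.of_sum_block {𝕜 κ σ : Type*} [RCLike 𝕜] [Fintype κ] [Fintype σ]
    [DecidableEq κ] [DecidableEq σ] {A A' : Matrix (κ ⊕ σ) (κ ⊕ σ) 𝕜} {β : κ ⊕ σ → 𝕜} {o : σ}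
    (hβ : β (Sum.inr o) = 0) {c : 𝕜} (hc : c ≠ 0) {ξ : σ → 𝕜} (hξ : Function.Injective ξ)
    (hdet : ∀ x, (A.toBlocks₂₂ + x • A'.toBlocks₂₂).det = c * ∏ s, (x - ξ s))
    (hdet' : A'.toBlocks₂₂.det ≠ 0) :
    RankOneCovered {Matrix.diagonal β, A, A'} (2 * Fintype.card (κ ⊕ σ) - 1) := by
  obtain ⟨lam, hlam⟩ := exists_injective_sum_extension (κ := κ) hξ
  -- Scaling the rows in `κ` by `ε` makes the pencil block triangular at `ε = 0`, with eigenvalues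
  -- `lam` prescribed on `κ` and `ξ` on `σ`. For `ε ≠ 0` the scaling is invertible.
  let D : 𝕜 → κ ⊕ σ → 𝕜 := fun ε => Sum.elim (fun _ => ε) (fun _ => 1)
  let P : 𝕜 → Matrix (κ ⊕ σ) (κ ⊕ σ) 𝕜 := fun ε =>
    Matrix.diagonal (Sum.elim (fun k => -lam k) 0) + Matrix.diagonal (D ε) * A
  let Q : 𝕜 → Matrix (κ ⊕ σ) (κ ⊕ σ) 𝕜 := fun ε =>
    Matrix.diagonal (Sum.elim 1 0) + Matrix.diagonal (D ε) * A'
  let f : 𝕜 × 𝕜 → 𝕜 := fun z => (P z.2 + z.1 • Q z.2).det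
  have hD : ∀ i, ContDiff 𝕜 1 fun z : 𝕜 × 𝕜 => D z.2 i := by
    rintro (i | i)
    · exact contDiff_snd
    · exact contDiff_const
  have hf : ContDiff 𝕜 1 f := by
    simp only [f, det_apply, P, Q, Matrix.add_apply, Matrix.smul_apply, diagonal_mul, smul_eq_mul]
    refine ContDiff.sum fun τ _ => ContDiff.const_smul _ (contDiff_prod fun i _ => ?_)
    exact (contDiff_const.add ((hD _).mul contDiff_const)).add
      (contDiff_fst.mul (contDiff_const.add ((hD _).mul contDiff_const)))
  have hP0 : ∀ x, P 0 + x • Q 0 = fromBlocks (Matrix.diagonal fun k => x - lam k) 0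
      (A.toBlocks₂₁ + x • A'.toBlocks₂₁) (A.toBlocks₂₂ + x • A'.toBlocks₂₂) := by
    intro x
    ext (i | i) (j | j)
    · by_cases hij : i = j
      · subst hij; simp [P, Q, D]; ring
      · simp [P, Q, D, hij]
    · simp [P, Q, D]
    · simp [P, Q, D, toBlocks₂₁]
    · simp [P, Q, D, toBlocks₂₂, diagonal_apply]
  have hQ0 : Q 0 = fromBlocks 1 0 A'.toBlocks₂₁ A'.toBlocks₂₂ := by
    ext (i | i) (j | j)
    · simp [Q, D, diagonal_apply, one_apply]
    · simp [Q, D]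
    · simp [Q, D, toBlocks₂₁]
    · simp [Q, D, toBlocks₂₂, diagonal_apply]
  have hf0 : ∀ x, f (x, 0) = c * ∏ i, (x - Sum.elim lam ξ i) := by
    intro x
    simp only [f, hP0, det_fromBlocks_zero₁₂, det_diagonal, hdet, Fintype.prod_sum_type,
      Sum.elim_inl, Sum.elim_inr]
    ring
  have hQev : ∀ᶠ ε in nhds (0 : 𝕜), (Q ε).det ≠ 0 := by
    have hcont : Continuous fun ε => (Q ε).det := by
      refine Continuous.matrix_det (continuous_matrix fun i j => ?_)
      have : Continuous fun ε => D ε i := by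
        rcases i with i | i
        · exact continuous_id
        · exact continuous_const
      simp only [Q, Matrix.add_apply, diagonal_mul]
      fun_prop
    refine hcont.continuousAt.eventually_ne ?_
    rw [hQ0, det_fromBlocks_zero₁₂]
    simpa using hdet'
  obtain ⟨ε, ⟨⟨x, hx, hroot⟩, hQ⟩, hε⟩ :=
    ((((eventually_exists_injective_zeros hf hc hlam hf0).and hQev).filter_mono
      nhdsWithin_le_nhds).and (self_mem_nhdsWithin (s := {0}ᶜ))).exists
  replace hε : ε ≠ 0 := hε
  have hcov := (((pencil (P := P ε) hQ hx hroot).mul_mul (Matrix.diagonal fun i => (D ε i)⁻¹)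
    (1 : Matrix (κ ⊕ σ) (κ ⊕ σ) 𝕜)).union (diagonal_off (F := 𝕜) (Sum.inr o : κ ⊕ σ)))
  have hcard : Fintype.card (κ ⊕ σ) + (Fintype.card (κ ⊕ σ) - 1) =
      2 * Fintype.card (κ ⊕ σ) - 1 := by
    have : 0 < Fintype.card (κ ⊕ σ) := Fintype.card_pos_iff.2 ⟨Sum.inr o⟩
    omega
  rw [hcard] at hcov
  have hDinv : ∀ i, (D ε i)⁻¹ * D ε i = 1 := by
    rintro (i | i) <;> simp [D, hε]
  -- Undoing the scaling recovers `X` up to a diagonal matrix; for the `w` used below it vanishes on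
  -- `σ`, hence at `o`.
  have hA : ∀ (X : Matrix (κ ⊕ σ) (κ ⊕ σ) 𝕜) (w : κ ⊕ σ → 𝕜), X =
      (Matrix.diagonal fun i => (D ε i)⁻¹) * (Matrix.diagonal w + Matrix.diagonal (D ε) * X) * 1 -
      Matrix.diagonal fun i => (D ε i)⁻¹ * w i := by
    intro X w
    rw [mul_one, mul_add, ← mul_assoc, diagonal_mul_diagonal, diagonal_mul_diagonal]
    simp [hDinv]
  refine hcov.of_subset_span ?_
  rintro X (rfl | rfl | rfl)
  · exact Submodule.subset_span (Or.inr ⟨β, hβ, rfl⟩)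
  · rw [hA X (Sum.elim (fun k => -lam k) 0)]
    refine Submodule.sub_mem _ (Submodule.subset_span (Or.inl ⟨P ε, by simp, rfl⟩))
      (Submodule.subset_span (Or.inr ⟨_, ?_, rfl⟩))
    simp
  · rw [hA X (Sum.elim 1 0)]
    refine Submodule.sub_mem _ (Submodule.subset_span (Or.inl ⟨Q ε, by simp, rfl⟩))
      (Submodule.subset_span (Or.inr ⟨_, ?_, rfl⟩))
    simp

open Matrix in
theorem RankOneCovered.of_block {𝕜 ι σ : Type*} [RCLike 𝕜] [Fintype ι] [Fintype σ]
    [DecidableEq ι] [DecidableEq σ] {A A' : Matrix ι ι 𝕜} {β : ι → 𝕜} {g : σ → ι}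
    (hg : Function.Injective g) {o : σ} (hβ : β (g o) = 0) {c : 𝕜} (hc : c ≠ 0) {ξ : σ → 𝕜}
    (hξ : Function.Injective ξ)
    (hdet : ∀ x, ((A + x • A').submatrix g g).det = c * ∏ s, (x - ξ s))
    (hdet' : (A'.submatrix g g).det ≠ 0) :
    RankOneCovered {Matrix.diagonal β, A, A'} (2 * Fintype.card ι - 1) := by
  classical
  obtain ⟨e, he⟩ := exists_sum_equiv_of_injective hg
  have hblock : ∀ X : Matrix ι ι 𝕜, (X.submatrix e e).toBlocks₂₂ = X.submatrix g g := by
    intro X; ext i j; simp [toBlocks₂₂, he]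
  have h := of_sum_block (A := A.submatrix e e) (A' := A'.submatrix e e) (β := β ∘ e) (o := o)
    (by simpa [he] using hβ) hc hξ (fun x => by rw [← hdet x, hblock, hblock]; rfl) (by simpa [hblock] using hdet')
  rw [Fintype.card_congr e] at h
  refine (h.image_submatrix e.symm e.symm).of_subset_span (Set.Subset.trans ?_ Submodule.subset_span)
  rintro X (rfl | rfl | rfl)
  · exact ⟨_, Or.inl rfl, by simp [← submatrix_diagonal_equiv]⟩
  · exact ⟨_, Or.inr (Or.inl rfl), by simp⟩
  · exact ⟨_, Or.inr (Or.inr rfl), by simp⟩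

/-! ### Finding a block with distinct eigenvalues -/

namespace RankOneCovered

open Matrix

theorem swap_last {F ι : Type*} [Field F] {B A A' : Matrix ι ι F} {m : ℕ}
    (h : RankOneCovered {B, A', A} m) : RankOneCovered {B, A, A'} m := by
  rwa [Set.pair_comm A A']

/-- The set `{B, A, A' + t • A}` spans `{B, A, A'}`. -/
theorem of_add_smul {F ι : Type*} [Field F] {B A A' : Matrix ι ι F} {m : ℕ} (t : F)
    (h : RankOneCovered {B, A, A' + t • A} m) : RankOneCovered {B, A, A'} m := by
  refine h.of_subset_span ?_
  rintro X (rfl | rfl | rfl)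
  · exact Submodule.subset_span (by simp)
  · exact Submodule.subset_span (by simp)
  · have : X = (X + t • A) - t • A := by simp
    rw [this]
    exact Submodule.sub_mem _ (Submodule.subset_span (by simp))
      (Submodule.smul_mem _ _ (Submodule.subset_span (by simp)))

variable {𝕜 ι : Type*} [RCLike 𝕜] [Fintype ι] [DecidableEq ι]

theorem of_corner_ne_zero_right {A A' : Matrix ι ι 𝕜} {β : ι → 𝕜} {o : ι} (hβ : β o = 0)
    (h : A' o o ≠ 0) : RankOneCovered {Matrix.diagonal β, A, A'} (2 * Fintype.card ι - 1) := by
  refine of_block (g := fun _ : Unit => o) (o := ()) (fun _ _ _ => rfl) hβ h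
    (ξ := fun _ => -(A o o / A' o o)) (fun _ _ _ => rfl) (fun x => ?_) ?_
  · simp
    field_simp
    ring
  · simpa using h

theorem of_corner_ne_zero {A A' : Matrix ι ι 𝕜} {β : ι → 𝕜} {o : ι} (hβ : β o = 0)
    (h : A o o ≠ 0 ∨ A' o o ≠ 0) :
    RankOneCovered {Matrix.diagonal β, A, A'} (2 * Fintype.card ι - 1) :=
  h.elim (fun h => (of_corner_ne_zero_right hβ h).swap_last) (of_corner_ne_zero_right hβ)

/-- Put a 1 in the corner of `A'` to reach the previous case, then erase column `o` by a right
multiplication, which fixes the original matrices. -/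
theorem of_column_eq_zero {A A' : Matrix ι ι 𝕜} {β : ι → 𝕜} {o : ι} (hβ : β o = 0)
    (h : ∀ i, A i o = 0) (h' : ∀ i, A' i o = 0) :
    RankOneCovered {Matrix.diagonal β, A, A'} (2 * Fintype.card ι - 1) := by
  have key := of_corner_ne_zero (A := A) (A' := A' + Matrix.single o o 1) hβ
    (Or.inr (by simp [h']))
  refine (key.mul_mul 1 (Matrix.diagonal fun i => if i = o then 0 else 1)).of_subset_span
    (Set.Subset.trans ?_ Submodule.subset_span)
  rintro X (rfl | rfl | rfl)
  · refine ⟨_, Or.inl rfl, ?_⟩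
    ext i j
    by_cases hj : j = o <;> by_cases hij : i = j <;> simp_all
  · refine ⟨_, Or.inr (Or.inl rfl), ?_⟩
    ext i j
    by_cases hj : j = o <;> simp_all
  · refine ⟨_, Or.inr (Or.inr rfl), ?_⟩
    ext i j
    by_cases hj : j = o
    · simp_all
    · simp [hj, Ne.symm hj]

theorem of_row_eq_zero {A A' : Matrix ι ι 𝕜} {β : ι → 𝕜} {o : ι} (hβ : β o = 0)
    (h : ∀ i, A o i = 0) (h' : ∀ i, A' o i = 0) :
    RankOneCovered {Matrix.diagonal β, A, A'} (2 * Fintype.card ι - 1) := by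
  have key := of_corner_ne_zero (A := A) (A' := A' + Matrix.single o o 1) hβ
    (Or.inr (by simp [h']))
  refine (key.mul_mul (Matrix.diagonal fun i => if i = o then 0 else 1) 1).of_subset_span
    (Set.Subset.trans ?_ Submodule.subset_span)
  rintro X (rfl | rfl | rfl)
  · refine ⟨_, Or.inl rfl, ?_⟩
    ext i j
    by_cases hj : i = o <;> by_cases hij : i = j <;> simp_all
  · refine ⟨_, Or.inr (Or.inl rfl), ?_⟩
    ext i j
    by_cases hj : i = o <;> simp_all
  · refine ⟨_, Or.inr (Or.inr rfl), ?_⟩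
    ext i j
    by_cases hj : i = o
    · simp_all
    · simp [hj, Ne.symm hj]

/-- Swapping column `o` with another column killed by the diagonal matrix. -/
theorem of_row_entry_ne_zero {A A' : Matrix ι ι 𝕜} {β : ι → 𝕜} {o i : ι} (hβ : β o = 0)
    (hi : β i = 0) (h : A o i ≠ 0 ∨ A' o i ≠ 0) :
    RankOneCovered {Matrix.diagonal β, A, A'} (2 * Fintype.card ι - 1) := by
  let e := Equiv.swap i o
  have key := of_corner_ne_zero (A := A.submatrix id e) (A' := A'.submatrix id e) hβ
    (by simpa [e] using h)
  refine (key.image_submatrix id e).of_subset_span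
    (Set.Subset.trans ?_ Submodule.subset_span)
  rintro X (rfl | rfl | rfl)
  · refine ⟨_, Or.inl rfl, ?_⟩
    ext a b
    simp only [submatrix_apply, id, diagonal_apply, e, Equiv.swap_apply_def]
    split_ifs <;> simp_all
  · exact ⟨_, Or.inr (Or.inl rfl), by ext a b; simp [e]⟩
  · exact ⟨_, Or.inr (Or.inr rfl), by ext a b; simp [e]⟩

/-- With zero corners, the pencil on `{o, i}` has determinant minus the product of its two
off-diagonal linear forms; `h` says that their roots differ. -/
theorem of_independent_entries_aux {A A' : Matrix ι ι 𝕜} {β : ι → 𝕜} {o i : ι} (hβ : β o = 0)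
    (hio : i ≠ o) (h0 : A o o = 0) (h0' : A' o o = 0) (hb : A' i o ≠ 0) (hc : A' o i ≠ 0)
    (h : A i o * A' o i ≠ A' i o * A o i) :
    RankOneCovered {Matrix.diagonal β, A, A'} (2 * Fintype.card ι - 1) := by
  refine of_block (g := ![o, i]) (o := 0) ?_ hβ (c := -(A' i o * A' o i))
    (neg_ne_zero.2 (mul_ne_zero hb hc))
    (ξ := ![-(A i o / A' i o), -(A o i / A' o i)]) ?_ (fun x => ?_) ?_
  · intro s t hst
    fin_cases s <;> fin_cases t <;> simp_all [eq_comm]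
  · have hne : A i o / A' i o ≠ A o i / A' o i := by
      rw [ne_eq, div_eq_div_iff hb hc]
      intro h'
      exact h (by rw [h']; ring)
    intro s t hst
    fin_cases s <;> fin_cases t <;> simp_all [eq_comm]
  · rw [det_fin_two]
    simp [h0, h0']
    field_simp
    ring
  · rw [det_fin_two]
    simp [h0', hb, hc]

theorem of_independent_entries {A A' : Matrix ι ι 𝕜} {β : ι → 𝕜} {o i : ι} (hβ : β o = 0)
    (hio : i ≠ o) (h0 : A o o = 0) (h0' : A' o o = 0)
    (h : A i o * A' o i ≠ A' i o * A o i) :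
    RankOneCovered {Matrix.diagonal β, A, A'} (2 * Fintype.card ι - 1) := by
  by_cases hbc : A' i o ≠ 0 ∧ A' o i ≠ 0
  · exact of_independent_entries_aux hβ hio h0 h0' hbc.1 hbc.2 h
  -- Adding `t • A` to `A'` preserves the span and the independence; `t = 1` or `t = -1` makes both
  -- entries nonzero.
  obtain ⟨t, ht⟩ : ∃ t : 𝕜, A' i o + t * A i o ≠ 0 ∧ A' o i + t * A o i ≠ 0 := by
    by_cases hb : A' i o = 0
    · have h1 : A i o ≠ 0 := by rintro h1; simp [hb, h1] at h
      have h2 : A' o i ≠ 0 := by rintro h2; simp [hb, h2] at h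
      by_cases h3 : A' o i + A o i = 0
      · refine ⟨-1, by simp [hb, h1], ?_⟩
        have : A o i = - A' o i := (neg_eq_of_add_eq_zero_right h3).symm
        rw [this]; ring_nf; simp [h2]
      · exact ⟨1, by simp [hb, h1], by simpa using h3⟩
    · have hc : A' o i = 0 := by by_contra hc; exact hbc ⟨hb, hc⟩
      have h2 : A o i ≠ 0 := by rintro h2; simp [hc, h2] at h
      by_cases h3 : A' i o + A i o = 0
      · refine ⟨-1, ?_, by simp [hc, h2]⟩
        have : A i o = - A' i o := (neg_eq_of_add_eq_zero_right h3).symm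
        rw [this]; ring_nf; simp [hb]
      · exact ⟨1, by simpa using h3, by simp [hc, h2]⟩
  refine of_add_smul t (of_independent_entries_aux hβ hio h0 ?_ ?_ ?_ ?_)
  · simp [h0, h0']
  · simpa using ht.1
  · simpa using ht.2
  · simp only [Matrix.add_apply, Matrix.smul_apply, smul_eq_mul]
    intro h'
    exact h (by linear_combination h')

/-- A simultaneous row and column operation reduces an independent pair of entries at positions
`(j, o)` and `(o, i)` to one at positions `(i, o)` and `(o, i)`. -/
theorem of_independent_cross_entries {A A' : Matrix ι ι 𝕜} {β : ι → 𝕜} {o i j : ι}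
    (hβ : β o = 0) (hi : β i ≠ 0) (hio : i ≠ o) (hjo : j ≠ o) (h0 : A o o = 0) (h0' : A' o o = 0)
    (h : A j o * A' o i ≠ A' j o * A o i) :
    RankOneCovered {Matrix.diagonal β, A, A'} (2 * Fintype.card ι - 1) := by
  by_cases hii : A i o * A' o i ≠ A' i o * A o i
  · exact of_independent_entries hβ hio h0 h0' hii
  push Not at hii
  have hij : i ≠ j := by rintro rfl; exact h hii
  -- Adding row `j` to row `i` disturbs `diag β` only at `(i, j)`, by `β j`; subtracting `t` times
  -- column `i` from column `j` cancels this.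
  let t := β j / β i
  let P := transvection i j (1 : 𝕜)
  let Q := transvection i j (-t)
  have hPinv : transvection i j (-1 : 𝕜) * P = 1 := by
    simp [P, transvection_mul_transvection_same _ _ hij]
  have hQinv : Q * transvection i j t = 1 := by
    simp [Q, transvection_mul_transvection_same _ _ hij]
  have hB : P * Matrix.diagonal β * Q = Matrix.diagonal β := by
    have hs : Matrix.single i j (1 : 𝕜) * Matrix.diagonal β = Matrix.single i j (β j) := by
      ext a b
      by_cases hb : j = b <;> simp [Matrix.single_apply, hb]
    have hs' : Matrix.diagonal β * Matrix.single i j (-t) = Matrix.single i j (-β j) := by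
      ext a b
      by_cases ha : i = a
      · subst ha; by_cases hb : j = b <;> simp [t, hb]; field_simp
      · simp [ha]
    simp only [P, Q, transvection, add_mul, mul_add, one_mul, mul_one, hs, hs']
    rw [Matrix.single_mul_single_of_ne _ _ _ _ hij.symm, add_zero, add_assoc,
      ← Matrix.single_add]
    simp
  have hent : ∀ X : Matrix ι ι 𝕜, (P * X * Q) i o = X i o + X j o ∧ (P * X * Q) o i = X o i ∧
      (P * X * Q) o o = X o o := by
    intro X
    refine ⟨?_, ?_, ?_⟩
    · simp only [P, Q]
      rw [mul_transvection_apply_of_ne _ _ _ _ hjo.symm, transvection_mul_apply_same, one_mul]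
    · simp only [P, Q]
      rw [mul_transvection_apply_of_ne _ _ _ _ hij,
        transvection_mul_apply_of_ne _ _ _ _ hio.symm]
    · simp only [P, Q]
      rw [mul_transvection_apply_of_ne _ _ _ _ hjo.symm,
        transvection_mul_apply_of_ne _ _ _ _ hio.symm]
  have key := of_independent_entries (A := P * A * Q) (A' := P * A' * Q) hβ hio
    (by rw [(hent A).2.2, h0]) (by rw [(hent A').2.2, h0'])
    (by
      rw [(hent A).1, (hent A).2.1, (hent A').1, (hent A').2.1]
      intro h'
      -- The new `(i, o)` entries are sums over rows `i` and `j`; by `hii` row `i` contributes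
      -- nothing to the determinant.
      exact h (by linear_combination h' - hii))
  have hback : ∀ X : Matrix ι ι 𝕜,
      transvection i j (-1 : 𝕜) * (P * X * Q) * transvection i j t = X := by
    intro X
    calc _ = (transvection i j (-1 : 𝕜) * P) * X * (Q * transvection i j t) := by
          simp only [mul_assoc]
      _ = X := by rw [hPinv, hQinv, one_mul, mul_one]
  refine (key.mul_mul (transvection i j (-1)) (transvection i j t)).of_subset_span
    (Set.Subset.trans ?_ Submodule.subset_span)
  rintro X (rfl | rfl | rfl)
  · refine ⟨_, Or.inl rfl, ?_⟩
    have := hback (Matrix.diagonal β)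
    rwa [hB] at this
  · exact ⟨_, Or.inr (Or.inl rfl), hback _⟩
  · exact ⟨_, Or.inr (Or.inr rfl), hback _⟩

end RankOneCovered

/-! ### Induction on the size -/

namespace RankOneCovered

open Matrix

/-- Matrices with vanishing row and column `o` are covered as soon as their restrictions to the
complement of `o` are. -/
theorem of_restrict {F ι : Type*} [Field F] [DecidableEq ι] {o : ι} {S : Set (Matrix ι ι F)}
    {m : ℕ} (hS : ∀ X ∈ S, ∀ a, X a o = 0 ∧ X o a = 0)
    (h : RankOneCovered ((fun X => X.submatrix (Subtype.val : {a // a ≠ o} → ι) Subtype.val) '' S)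
      m) : RankOneCovered S m := by
  refine (h.image (Φ := {
      toFun := fun Y => of fun a b =>
        if ha : a ≠ o then if hb : b ≠ o then Y ⟨a, ha⟩ ⟨b, hb⟩ else 0 else 0
      map_add' := fun Y Z => by ext a b; simp only [of_apply, Matrix.add_apply]; split_ifs <;> simp
      map_smul' := fun c Y => by
        ext a b; simp only [of_apply, Matrix.smul_apply]; split_ifs <;> simp })
    (p := fun u a => if ha : a ≠ o then u ⟨a, ha⟩ else 0)
    (q := fun u a => if ha : a ≠ o then u ⟨a, ha⟩ else 0) ?_).of_subset_span
    (Set.Subset.trans ?_ Submodule.subset_span)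
  · intro u v
    ext a b
    simp only [LinearMap.coe_mk, AddHom.coe_mk, of_apply, vecMulVec_apply]
    split_ifs <;> simp
  · intro X hX
    refine ⟨_, ⟨X, hX, rfl⟩, ?_⟩
    ext a b
    simp only [LinearMap.coe_mk, AddHom.coe_mk, of_apply, submatrix_apply]
    split_ifs with ha hb
    · rfl
    · rw [not_not.1 hb, (hS X hX a).1]
    · rw [not_not.1 ha, (hS X hX b).2]

/-- If row and column `o` only involve `A`, two rank-one matrices reduce the size by one while
making the rest of `A` singular. -/
theorem of_peel {F ι : Type*} [Field F] [Fintype ι] [DecidableEq ι] {B A A' : Matrix ι ι F}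
    {o i : ι} (hB : ∀ a, B a o = 0 ∧ B o a = 0) (hA' : ∀ a, A' a o = 0 ∧ A' o a = 0)
    (hA : A o o = 0) (hi : A o i ≠ 0)
    (ih : ∀ B A A' : Matrix {a // a ≠ o} {a // a ≠ o} F, B.det = 0 →
      RankOneCovered {B, A, A'} (2 * Fintype.card {a // a ≠ o} - 1)) :
    RankOneCovered {B, A, A'} (2 * Fintype.card ι - 1) := by
  have hio : i ≠ o := by rintro rfl; exact hi hA
  -- This scaling makes the second correction clear both row `o` and column `i`, so the remainder
  -- stays singular after deleting index `o`.
  let u : ι → F := fun a => A a i / A o i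
  let C : Matrix ι ι F :=
    A - vecMulVec (fun a => A a o) (Pi.single o 1) - vecMulVec u (fun a => A o a)
  have hC : ∀ a b, C a b = A a b - A a o * (Pi.single o 1 : ι → F) b - A a i / A o i * A o b :=
    fun a b => rfl
  have hCo : ∀ a, C a o = 0 ∧ C o a = 0 := by
    intro a
    simp [hC, hA, hi]
  have hCi : ∀ a, C a i = 0 := by
    intro a
    simp [hC, hio, hi]
  have key : RankOneCovered {C, B, A'} (2 * Fintype.card {a // a ≠ o} - 1) := by
    refine of_restrict (o := o) ?_ ?_
    · rintro X (rfl | rfl | rfl)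
      exacts [hCo, hB, hA']
    · simp only [Set.image_insert_eq, Set.image_singleton]
      exact ih _ _ _ (det_eq_zero_of_column_eq_zero ⟨i, hio⟩ fun a => hCi a)
  have hcov := key.union (pair_vecMulVec (fun a => A a o) (Pi.single o 1) u (fun a => A o a))
  -- The index `i` survives, so the truncated subtraction is a true one.
  have hcard : 2 * Fintype.card {a // a ≠ o} - 1 + 2 = 2 * Fintype.card ι - 1 := by
    have h1 : 0 < Fintype.card {a // a ≠ o} := Fintype.card_pos_iff.2 ⟨⟨i, hio⟩⟩
    have h2 : Fintype.card {a // a ≠ o} = Fintype.card ι - 1 := by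
      simp [Fintype.card_subtype_compl]
    omega
  rw [hcard] at hcov
  refine hcov.of_subset_span ?_
  rintro X (rfl | rfl | rfl)
  · exact Submodule.subset_span (by simp)
  · have : X - vecMulVec (fun a => X a o) (Pi.single o 1) - vecMulVec u (fun a => X o a) +
        vecMulVec u (fun a => X o a) + vecMulVec (fun a => X a o) (Pi.single o 1) = X := by
      rw [sub_add_cancel, sub_add_cancel]
    refine Eq.subst (motive := (· ∈ (_ : Set (Matrix ι ι F)))) this
      (Submodule.add_mem _ (Submodule.add_mem _ ?_ ?_) ?_)
    · exact Submodule.subset_span (Or.inl (Or.inl rfl))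
    · exact Submodule.subset_span (Or.inr (Or.inr rfl))
    · exact Submodule.subset_span (Or.inr (Or.inl rfl))
  · exact Submodule.subset_span (by simp)

/-- Column and row `o` of `A'` are the same multiple of those of `A`, so subtracting that multiple
of `A` clears both and `of_peel` applies. -/
theorem of_dependent_entries {F ι : Type*} [Field F] [Fintype ι] [DecidableEq ι]
    {B A A' : Matrix ι ι F} {o i j : ι} (hB : ∀ a, B a o = 0 ∧ B o a = 0)
    (hA : A o o = 0) (hdep : ∀ k l, A k o * A' o l = A' k o * A o l)
    (hi : A o i ≠ 0) (hj : A j o ≠ 0 ∨ A' j o ≠ 0)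
    (ih : ∀ B A A' : Matrix {a // a ≠ o} {a // a ≠ o} F, B.det = 0 →
      RankOneCovered {B, A, A'} (2 * Fintype.card {a // a ≠ o} - 1)) :
    RankOneCovered {B, A, A'} (2 * Fintype.card ι - 1) := by
  have hcol : ∀ k, A' k o = A' o i / A o i * A k o := by
    intro k
    have := hdep k i
    field_simp
    linear_combination -this
  have hj' : A j o ≠ 0 := hj.elim id fun h h0 => h (by rw [hcol, h0, mul_zero])
  have hrow : ∀ l, A' o l = A' o i / A o i * A o l := by
    intro l
    have h1 := hdep j l
    rw [hcol j] at h1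
    exact mul_left_cancel₀ hj' (by rw [h1]; ring)
  refine of_add_smul (-(A' o i / A o i)) (of_peel hB (fun a => ⟨?_, ?_⟩) hA hi ih)
  · simp only [Matrix.add_apply, Matrix.smul_apply, smul_eq_mul]
    linear_combination hcol a
  · simp only [Matrix.add_apply, Matrix.smul_apply, smul_eq_mul]
    linear_combination hrow a

theorem of_diagonal {𝕜 ι : Type*} [RCLike 𝕜] [Fintype ι] [DecidableEq ι]
    {A A' : Matrix ι ι 𝕜} {β : ι → 𝕜} {o : ι} (hβ : β o = 0)
    (ih : ∀ B A A' : Matrix {a // a ≠ o} {a // a ≠ o} 𝕜, B.det = 0 →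
      RankOneCovered {B, A, A'} (2 * Fintype.card {a // a ≠ o} - 1)) :
    RankOneCovered {Matrix.diagonal β, A, A'} (2 * Fintype.card ι - 1) := by
  by_cases hd : A o o ≠ 0 ∨ A' o o ≠ 0
  · exact of_corner_ne_zero hβ hd
  push Not at hd
  obtain ⟨h0, h0'⟩ := hd
  by_cases hcross : ∀ k l, A k o * A' o l = A' k o * A o l
  · have hB : ∀ a, Matrix.diagonal β a o = 0 ∧ Matrix.diagonal β o a = 0 := by
      intro a
      by_cases ha : a = o
      · subst ha; simp [hβ]
      · simp [ha, Ne.symm ha]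
    by_cases hcol : ∀ k, A k o = 0 ∧ A' k o = 0
    · exact of_column_eq_zero hβ (fun k => (hcol k).1) (fun k => (hcol k).2)
    push Not at hcol
    obtain ⟨j, hj⟩ := hcol
    replace hj : A j o ≠ 0 ∨ A' j o ≠ 0 := by tauto
    by_cases hrow : ∀ l, A o l = 0
    · by_cases hrow' : ∀ l, A' o l = 0
      · exact of_row_eq_zero hβ hrow hrow'
      push Not at hrow'
      obtain ⟨i, hi⟩ := hrow'
      exact (of_dependent_entries hB h0' (fun k l => (hcross k l).symm) hi hj.symm ih).swap_last
    · push Not at hrow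
      obtain ⟨i, hi⟩ := hrow
      exact of_dependent_entries hB h0 hcross hi hj ih
  · push Not at hcross
    obtain ⟨j, i, h⟩ := hcross
    have hjo : j ≠ o := by rintro rfl; simp [h0, h0'] at h
    have hio : i ≠ o := by rintro rfl; simp [h0, h0'] at h
    by_cases hi : β i = 0
    · refine of_row_entry_ne_zero hβ hi ?_
      by_contra hcon
      push Not at hcon
      simp [hcon.1, hcon.2] at h
    · exact of_independent_cross_entries hβ hi hio hjo h0 h0' h

/-- Three square matrices of size `n`, one of them singular, lie in the span of `2 n - 1` rank-one
matrices. -/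
theorem of_det_eq_zero {𝕜 : Type*} [RCLike 𝕜] {ι : Type*} [Fintype ι] [DecidableEq ι]
    {B A A' : Matrix ι ι 𝕜} (hB : B.det = 0) :
    RankOneCovered {B, A, A'} (2 * Fintype.card ι - 1) := by
  induction hn : Fintype.card ι generalizing ι with
  | zero =>
    have := Fintype.card_eq_zero_iff.1 hn
    simp at hB
  | succ n ih =>
    obtain ⟨L, L', β, hL⟩ := Pivot.exists_list_transvec_mul_diagonal_mul_list_transvec B
    set P := (L.map TransvectionStruct.toMatrix).prod
    set Q := (L'.map TransvectionStruct.toMatrix).prod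
    have hP : P.det = 1 := TransvectionStruct.det_toMatrix_prod L
    have hQ : Q.det = 1 := TransvectionStruct.det_toMatrix_prod L'
    have hβ : ∏ a, β a = 0 := by
      rw [hL, det_mul, det_mul, hP, hQ, det_diagonal] at hB
      simpa using hB
    obtain ⟨o, -, ho⟩ := Finset.prod_eq_zero_iff.1 hβ
    have hcard : Fintype.card {a // a ≠ o} = n := by
      simp [Fintype.card_subtype_compl, hn]
    have key := of_diagonal (A := P⁻¹ * A * Q⁻¹) (A' := P⁻¹ * A' * Q⁻¹) ho (fun B A A' hB => by
      rw [hcard]; exact ih hB hcard)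
    rw [hn] at key
    have hback : ∀ X, P * (P⁻¹ * X * Q⁻¹) * Q = X := by
      intro X
      calc _ = (P * P⁻¹) * X * (Q⁻¹ * Q) := by simp only [mul_assoc]
        _ = X := by
          rw [mul_nonsing_inv _ (by simp [hP]), nonsing_inv_mul _ (by simp [hQ]), one_mul, mul_one]
    refine (key.mul_mul P Q).of_subset_span (Set.Subset.trans ?_ Submodule.subset_span)
    rintro X (rfl | rfl | rfl)
    · exact ⟨_, Or.inl rfl, hL.symm⟩
    · exact ⟨_, Or.inr (Or.inl rfl), hback _⟩
    · exact ⟨_, Or.inr (Or.inr rfl), hback _⟩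

/-! ### Producing a singular slice -/

theorem of_mem_span {𝕜 ι : Type*} [RCLike 𝕜] [Fintype ι] [DecidableEq ι]
    {A₁ A₂ A₃ M : Matrix ι ι 𝕜} (hM : M ∈ Submodule.span 𝕜 {A₁, A₂, A₃}) (hM0 : M ≠ 0)
    (hdet : M.det = 0) : RankOneCovered {A₁, A₂, A₃} (2 * Fintype.card ι - 1) := by
  have exchange : ∀ {X Y Z : Matrix ι ι 𝕜} {a b c : 𝕜}, M = a • X + b • Y + c • Z → a ≠ 0 →
      RankOneCovered {X, Y, Z} (2 * Fintype.card ι - 1) := by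
    intro X Y Z a b c h ha
    refine (of_det_eq_zero (A := Y) (A' := Z) hdet).of_subset_span ?_
    rintro W (rfl | rfl | rfl)
    · have : W = a⁻¹ • (M - b • Y - c • Z) := by
        rw [h, add_sub_right_comm, add_sub_cancel_right, add_sub_cancel_right, inv_smul_smul₀ ha]
      rw [this]
      refine Submodule.smul_mem _ _ (Submodule.sub_mem _ (Submodule.sub_mem _ ?_ ?_) ?_)
      · exact Submodule.subset_span (by simp)
      · exact Submodule.smul_mem _ _ (Submodule.subset_span (by simp))
      · exact Submodule.smul_mem _ _ (Submodule.subset_span (by simp))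
    · exact Submodule.subset_span (by simp)
    · exact Submodule.subset_span (by simp)
  obtain ⟨a, b, c, rfl⟩ := Submodule.mem_span_triple.1 hM
  by_cases ha : a = 0
  · by_cases hb : b = 0
    · by_cases hc : c = 0
      · simp [ha, hb, hc] at hM0
      · have h := exchange (X := A₃) (Y := A₁) (Z := A₂) (a := c) (b := a) (c := b) (by abel) hc
        rwa [Set.insert_comm, Set.pair_comm] at h
    · have h := exchange (X := A₂) (Y := A₁) (Z := A₃) (a := b) (b := a) (c := c) (by abel) hb
      rwa [Set.insert_comm] at h
  · exact exchange rfl ha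

/-- The bound holds whenever characteristic polynomials of the given size have a root. -/
theorem of_exists_charpoly_root {𝕜 ι : Type*} [RCLike 𝕜] [Fintype ι] [DecidableEq ι]
    (hroot : ∀ N : Matrix ι ι 𝕜, ∃ x, N.charpoly.IsRoot x) (A₁ A₂ A₃ : Matrix ι ι 𝕜) :
    RankOneCovered {A₁, A₂, A₃} (2 * Fintype.card ι - 1) := by
  by_cases h1 : A₁.det = 0
  · exact of_det_eq_zero h1
  obtain ⟨x, hx⟩ := hroot (A₁⁻¹ * A₂)
  have hu : IsUnit A₁.det := isUnit_iff_ne_zero.2 h1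
  have hdet : (x • A₁ - A₂).det = 0 := by
    have h2 : x • A₁ - A₂ = A₁ * (scalar ι x - A₁⁻¹ * A₂) := by
      rw [mul_sub, ← mul_assoc, mul_nonsing_inv _ hu, one_mul, scalar_apply, ← smul_one_eq_diagonal,
        mul_smul_comm, mul_one]
    rw [h2, det_mul, ← eval_charpoly, hx, mul_zero]
  -- The singular matrix may be zero here: `of_det_eq_zero` allows it, and `A₂` is still recovered
  -- from it and `A₁`.
  refine (of_det_eq_zero (A := A₁) (A' := A₃) hdet).of_subset_span ?_
  rintro W (rfl | rfl | rfl)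
  · exact Submodule.subset_span (by simp)
  · have : W = x • A₁ - (x • A₁ - W) := by simp
    rw [this]
    exact Submodule.sub_mem _ (Submodule.smul_mem _ _ (Submodule.subset_span (by simp)))
      (Submodule.subset_span (by simp))
  · exact Submodule.subset_span (by simp)

end RankOneCovered

/-! ### Roots of odd-degree polynomials and the conclusion -/

open Polynomial Filter in
theorem Polynomial.Monic.exists_isRoot_real_of_odd_natDegree {p : ℝ[X]} (hp : p.Monic)
    (hodd : Odd p.natDegree) : ∃ x, p.IsRoot x := by
  have hpos : 0 < p.degree := natDegree_pos_iff_degree_pos.1 hodd.pos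
  have htop : Tendsto (fun x => p.eval x) atTop atTop :=
    p.tendsto_atTop_of_leadingCoeff_nonneg hpos (by simp [hp.leadingCoeff])
  have hq : Tendsto (fun x => (p.comp (-X)).eval x) atTop atBot := by
    refine (p.comp (-X)).tendsto_atBot_of_leadingCoeff_nonpos ?_ ?_
    · rw [← natDegree_pos_iff_degree_pos, natDegree_comp]
      simpa using hodd.pos
    · rw [leadingCoeff_comp (by simp)]
      simp [hp.leadingCoeff, hodd.neg_one_pow]
  have hbot : Tendsto (fun x => p.eval x) atBot atBot := by
    have := hq.comp tendsto_neg_atBot_atTop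
    refine this.congr fun x => by simp
  exact (p.continuous.surjective htop hbot) 0

open Polynomial in
theorem RCLike.exists_isRoot_of_odd_natDegree {𝕜 : Type*} [RCLike 𝕜] {p : 𝕜[X]} (hp : p.Monic)
    (hodd : Odd p.natDegree) : ∃ x, p.IsRoot x := by
  have transfer : ∀ {K : Type} [Field K] (e : 𝕜 ≃+* K),
      (∃ x, (p.map e.toRingHom).IsRoot x) → ∃ x, p.IsRoot x := by
    rintro K _ e ⟨x, hx⟩
    refine ⟨e.symm x, e.injective ?_⟩
    have : (p.map e.toRingHom).eval (e.toRingHom (e.symm x)) = 0 := by simpa using hx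
    rw [eval_map_apply] at this
    simpa using this
  obtain h | h := RCLike.I_eq_zero_or_im_I_eq_one (K := 𝕜)
  · refine transfer (RCLike.realRingEquiv h) ((hp.map _).exists_isRoot_real_of_odd_natDegree ?_)
    rwa [hp.natDegree_map]
  · refine transfer (RCLike.complexRingEquiv h) (IsAlgClosed.exists_root _ ?_)
    rw [Polynomial.degree_map]
    exact (natDegree_pos_iff_degree_pos.1 hodd.pos).ne'

/-- `𝕜` is `ℝ` or `ℂ` (class `RCLike`). The bounds are stated in `ℤ`. -/
theorem mainTheorem1 :
    (∀ (𝕜 : Type) [RCLike 𝕜] (n : ℕ) (A₁ A₂ A₃ : Matrix (Fin n) (Fin n) 𝕜),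
      (∃ M ∈ Submodule.span 𝕜 {A₁, A₂, A₃}, M ≠ 0 ∧ M.det = 0) →
        (tensorRank (tensorOfSlices ![A₁, A₂, A₃]) : ℤ) ≤ 2 * (n : ℤ) - 1) ∧
    (∀ (n : ℕ) (A₁ A₂ A₃ : Matrix (Fin n) (Fin n) ℂ), 1 ≤ n →
      (tensorRank (tensorOfSlices ![A₁, A₂, A₃]) : ℤ) ≤ 2 * (n : ℤ) - 1) ∧
    (∀ (𝕜 : Type) [RCLike 𝕜] (n : ℕ) (A₁ A₂ A₃ : Matrix (Fin n) (Fin n) 𝕜), Odd n →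
      (tensorRank (tensorOfSlices ![A₁, A₂, A₃]) : ℤ) ≤ 2 * (n : ℤ) - 1) := by
  have bound : ∀ {𝕜 : Type} [RCLike 𝕜] {n : ℕ} {A₁ A₂ A₃ : Matrix (Fin n) (Fin n) 𝕜}, 1 ≤ n →
      RankOneCovered {A₁, A₂, A₃} (2 * Fintype.card (Fin n) - 1) →
      (tensorRank (tensorOfSlices ![A₁, A₂, A₃]) : ℤ) ≤ 2 * (n : ℤ) - 1 := by
    intro 𝕜 _ n A₁ A₂ A₃ hn h
    have := h.tensorRank_le
    rw [Fintype.card_fin] at this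
    omega
  refine ⟨fun 𝕜 _ n A₁ A₂ A₃ ⟨M, hM, hM0, hdet⟩ => bound ?_ (.of_mem_span hM hM0 hdet),
    fun n A₁ A₂ A₃ hn => bound hn (.of_exists_charpoly_root (fun N => ?_) _ _ _),
    fun 𝕜 _ n A₁ A₂ A₃ hn => bound hn.pos (.of_exists_charpoly_root (fun N => ?_) _ _ _)⟩
  -- A nonzero `M` forces `n ≥ 1`, so the bound in `ℕ` agrees with the one in `ℤ`.
  · rcases Nat.eq_zero_or_pos n with rfl | hn
    · exact absurd (Subsingleton.elim M 0) hM0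
    · exact hn
  · refine IsAlgClosed.exists_root _ ?_
    rw [Matrix.charpoly_degree_eq_dim, Fintype.card_fin]
    exact_mod_cast Nat.one_le_iff_ne_zero.1 hn
  · refine RCLike.exists_isRoot_of_odd_natDegree N.charpoly_monic ?_
    rwa [Matrix.charpoly_natDegree_eq_dim, Fintype.card_fin]
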